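/- All graphs are finite and simple. A graph $G=(V,E)$ is a \emph{$k$-threshold graph} ($k\ge 0$) if there are real thresholds $\theta_1<\theta_2<\dots<\theta_k$ and a rank $r(v)\in\mathbb R$ for each $v\in V$ such that, for any two distinct vertices $u,v\in V$, $uv\in E$ if and only if $r(u)+r(v)\ge\theta_i$ holds for an odd number of indices $i$. The \emph{threshold number} $\Theta(G)$ is the least $k\ge 0$ such that $G$ is a $k$-threshold graph (so an edgeless graph has $\Theta(G)=0$). Let $K_{n_1\times 1,n_2\times 2,n_3\times 3}$ be the complete multipartite graph with $n_1$ parts of size $1$, $n_2$ parts of size $2$ and $n_3$ parts of size $3$, and let $n_1K_1\cup n_2K_2\cup n_3K_3$ be its complement, the disjoint union of $n_1$ copies of $K_1$, $n_2$ copies of $K_2$ and $n_3$ copies of $K_3$. **Theorem.** Let $n_1,n_2,n_3$ be nonnegative integers, and for integers $m\ge 0$ let $p_m=m+\binom m3+2$ and $q_m=m+\binom m3+1$. (I) Suppose $n_1+n_2+n_3\ge 2$. (i) If $n_3\le 2$, then $$\Theta(K_{n_1\times 1,n_2\times 2,n_3\times 3})=\begin{cases}1&\text{if } n_2+n_3\le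 1,\\ 2&\text{if } n_2+n_3=2,\\ 3&\text{if } n_2+n_3\ge 3.\end{cases}$$ (ii) If $n_3\ge 3$, then there is a unique integer $m\ge 1$ with $p_{m-1}\le n_3\le p_m-1$, and for this $m$ $$\Theta(K_{n_1\times 1,n_2\times 2,n_3\times 3})=\begin{cases}2m&\text{if } n_3=p_{m-1},\\ 2m+1&\text{if } p_{m-1}+1\le n_3\le p_m-1.\end{cases}$$ (II) Suppose $n_1+n_2+n_3\ge 1$. (i) If $n_3\le 1$, then $$\Theta(n_1K_1\cup n_2K_2\cup n_3K_3)=\begin{cases}0&\text{if } n_2+n_3=0,\\ 1&\text{if } n_2+n_3=1,\\ 2&\text{if } n_2+n_3\ge 2.\end{cases}$$ (ii) If $n_3\ge 2$, then there is a unique integer $m\ge 1$ with $q_{m-1}\le n_3\le q_m-1$, and for this $m$ $$\Theta(n_1K_1\cup n_2K_2\cup n_3K_3)=\begin{cases}2m-1&\text{if } n_3=q_{m-1},\\ 2m&\text{if } q_{m-1}+1\le n_3\le q_m-1.\end{cases}$$ -/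

import Mathlib

/-- `G` is a `k`-threshold graph: there are `k` distinct real thresholds (the elements of the finite
set `θ`) and a rank assignment `r` such that two distinct vertices `u`, `v` are adjacent
if and only if `r u + r v ≥ t` holds for an odd number of thresholds `t`. -/
def IsKThreshold {V : Type*} (G : SimpleGraph V) (k : ℕ) : Prop :=
  ∃ θ : Finset ℝ, θ.card = k ∧ ∃ r : V → ℝ,
    ∀ u v : V, u ≠ v → (G.Adj u v ↔ Odd (θ.filter (fun t => t ≤ r u + r v)).card)

/-- The threshold number `Θ(G)`: the least `k` for which `G` is a `k`-threshold graph.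
Here `k = 0` is allowed, so that an edgeless graph has threshold number `0`. -/
noncomputable def thresholdNumber {V : Type*} (G : SimpleGraph V) : ℕ :=
  sInf {k : ℕ | IsKThreshold G k}

/-- Every finite graph is a `k`-threshold graph for some `k`. -/
theorem exists_isKThreshold {V : Type*} [Finite V] (G : SimpleGraph V) :
    ∃ k, IsKThreshold G k := by
  classical
  obtain ⟨n, ⟨e⟩⟩ := Finite.exists_equiv_fin V
  have : Fintype V := Fintype.ofFinite V
  -- distinct pairs have distinct sums of powers of two
  have key : ∀ a b c d : ℕ, a < b → c < d → 2 ^ a + 2 ^ b = 2 ^ c + 2 ^ d → a = c ∧ b = d := by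
    intro a b c d hab hcd h
    have hbd : ∀ a b c d : ℕ, a < b → b < d → 2 ^ a + 2 ^ b < 2 ^ c + 2 ^ d := by
      intro a b c d hab hbd
      have h1 : 2 ^ a < 2 ^ b := Nat.pow_lt_pow_right (by norm_num) hab
      have h2 : 2 ^ (b + 1) ≤ 2 ^ d := Nat.pow_le_pow_right (by norm_num) hbd
      have h3 : 0 < 2 ^ c := Nat.pow_pos (by norm_num)
      rw [pow_succ] at h2
      omega
    have hb : b = d := by
      rcases lt_trichotomy b d with hlt | heq | hgt
      · have := hbd a b c d hab hlt
        omega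
      · exact heq
      · have := hbd c d a b hcd hgt
        omega
    subst hb
    exact ⟨Nat.pow_right_injective le_rfl (by simpa using h), rfl⟩
  let w : V → ℕ := fun v => 2 ^ (e v : ℕ)
  let S : Finset ℕ :=
    (Finset.univ.filter (fun x : V × V => G.Adj x.1 x.2)).image (fun x => w x.1 + w x.2)
  have hS : ∀ u v : V, u ≠ v → (G.Adj u v ↔ w u + w v ∈ S) := by
    intro u v huv
    constructor
    · intro h
      exact Finset.mem_image.2 ⟨(u, v), by simpa using h, rfl⟩
    · intro h
      obtain ⟨⟨x, y⟩, hxy, hsum⟩ := Finset.mem_image.1 h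
      have hadj : G.Adj x y := by simpa using hxy
      have inj : ∀ a b : V, (e a : ℕ) = e b → a = b := fun a b hab => e.injective (Fin.ext hab)
      have hne1 : (e u : ℕ) ≠ e v := fun hh => huv (inj _ _ hh)
      have hne2 : (e x : ℕ) ≠ e y := fun hh => hadj.ne (inj _ _ hh)
      simp only [w] at hsum
      rcases lt_or_gt_of_ne hne1 with h1 | h1 <;> rcases lt_or_gt_of_ne hne2 with h2 | h2
      · obtain ⟨ha, hb⟩ := key _ _ _ _ h2 h1 hsum
        rw [← inj _ _ ha, ← inj _ _ hb]; exact hadj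
      · obtain ⟨ha, hb⟩ := key _ _ _ _ h2 h1 (by rw [add_comm]; exact hsum)
        rw [← inj _ _ ha, ← inj _ _ hb]; exact hadj.symm
      · obtain ⟨ha, hb⟩ := key _ _ _ _ h2 h1 (by rw [hsum, add_comm])
        rw [← inj _ _ ha, ← inj _ _ hb]; exact hadj.symm
      · obtain ⟨ha, hb⟩ := key _ _ _ _ h2 h1 (by rw [add_comm, hsum, add_comm])
        rw [← inj _ _ ha, ← inj _ _ hb]; exact hadj
  -- thresholds `s` and `s + 1/2` for every edge sum `s`
  let A : Finset ℝ := S.image (fun s : ℕ => (s : ℝ))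
  let B : Finset ℝ := S.image (fun s : ℕ => (s : ℝ) + 1 / 2)
  have hAB : Disjoint A B := by
    rw [Finset.disjoint_left]
    intro t hA hB
    obtain ⟨a, -, rfl⟩ := Finset.mem_image.1 hA
    obtain ⟨b, -, hb⟩ := Finset.mem_image.1 hB
    have h2 : 2 * b + 1 = 2 * a := by
      have : (2 * b + 1 : ℝ) = 2 * a := by linarith
      exact_mod_cast this
    omega
  refine ⟨_, A ∪ B, rfl, fun v => (w v : ℝ), fun u v huv => ?_⟩
  rw [hS u v huv]
  have hcast : (w u : ℝ) + (w v : ℝ) = ((w u + w v : ℕ) : ℝ) := by push_cast; rfl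
  rw [hcast]
  generalize w u + w v = N
  have hA : (A.filter (fun t => t ≤ (N : ℝ))).card = (S.filter (fun s => s ≤ N)).card := by
    rw [Finset.filter_image, Finset.card_image_of_injective _ Nat.cast_injective]
    simp
  have hB : (B.filter (fun t => t ≤ (N : ℝ))).card = (S.filter (fun s => s < N)).card := by
    rw [Finset.filter_image, Finset.card_image_of_injective]
    · congr 1
      ext s
      simp only [Finset.mem_filter, and_congr_right_iff]
      intro _
      constructor
      · intro h
        have : (s : ℝ) < N := by linarith
        exact_mod_cast this
      · intro h
        have : (s : ℝ) + 1 ≤ N := by exact_mod_cast h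
        linarith
    · intro a b hab
      have : (a : ℝ) = b := by simpa using hab
      exact_mod_cast this
  rw [Finset.filter_union, Finset.card_union_of_disjoint
    (Finset.disjoint_filter_filter hAB), hA, hB]
  by_cases hN : N ∈ S
  · have : S.filter (fun s => s ≤ N) = insert N (S.filter (fun s => s < N)) := by
      ext s
      simp only [Finset.mem_filter, Finset.mem_insert]
      constructor
      · rintro ⟨h1, h2⟩
        rcases h2.eq_or_lt with h | h
        · exact Or.inl h
        · exact Or.inr ⟨h1, h⟩
      · rintro (rfl | ⟨h1, h2⟩)
        · exact ⟨hN, le_rfl⟩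
        · exact ⟨h1, h2.le⟩
    rw [this, Finset.card_insert_of_notMem (by simp)]
    simp only [hN, true_iff]
    exact ⟨(S.filter (fun s => s < N)).card, by ring⟩
  · have : S.filter (fun s => s ≤ N) = S.filter (fun s => s < N) := by
      ext s
      simp only [Finset.mem_filter, and_congr_right_iff]
      intro hs
      have : s ≠ N := fun h => hN (h ▸ hs)
      omega
    rw [this]
    simp only [hN, false_iff, Nat.not_odd_iff_even]
    exact ⟨_, rfl⟩

/-- For a finite graph the infimum in the definition of the threshold number is attained. -/
theorem isLeast_thresholdNumber {V : Type*} [Finite V] (G : SimpleGraph V) :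
    IsLeast {k : ℕ | IsKThreshold G k} (thresholdNumber G) :=
  ⟨Nat.sInf_mem (exists_isKThreshold G), fun _ hk => Nat.sInf_le hk⟩

/-- The sizes of the parts (clusters): `n₁` of size `1`, `n₂` of size `2` and `n₃` of size `3`. -/
def partSize (n₁ n₂ n₃ : ℕ) : Fin n₁ ⊕ Fin n₂ ⊕ Fin n₃ → ℕ :=
  Sum.elim (fun _ => 1) (Sum.elim (fun _ => 2) (fun _ => 3))

/-- The complete multipartite graph `K_{n₁×1, n₂×2, n₃×3}`. -/
def multipartite123 (n₁ n₂ n₃ : ℕ) :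
    SimpleGraph (Σ i : Fin n₁ ⊕ Fin n₂ ⊕ Fin n₃, Fin (partSize n₁ n₂ n₃ i)) :=
  SimpleGraph.completeMultipartiteGraph (fun i => Fin (partSize n₁ n₂ n₃ i))

/-- The cluster graph `n₁ K₁ ∪ n₂ K₂ ∪ n₃ K₃`: two distinct vertices are adjacent if and only if
they lie in the same cluster. -/
def cluster123 (n₁ n₂ n₃ : ℕ) :
    SimpleGraph (Σ i : Fin n₁ ⊕ Fin n₂ ⊕ Fin n₃, Fin (partSize n₁ n₂ n₃ i)) where
  Adj x y := x ≠ y ∧ x.1 = y.1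
  symm := ⟨fun _ _ h => ⟨h.1.symm, h.2.symm⟩⟩
  loopless := ⟨fun _ h => h.1 rfl⟩

/-- The cluster graph is the complement of the complete multipartite graph. -/
theorem compl_multipartite123 (n₁ n₂ n₃ : ℕ) :
    (multipartite123 n₁ n₂ n₃)ᶜ = cluster123 n₁ n₂ n₃ := by
  ext x y
  simp [multipartite123, cluster123, SimpleGraph.completeMultipartiteGraph]

/-- `p_m = m + C(m, 3) + 2`. -/
def pSeq (m : ℕ) : ℕ := m + m.choose 3 + 2

/-- `q_m = m + C(m, 3) + 1`. -/
def qSeq (m : ℕ) : ℕ := m + m.choose 3 + 1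

/-! ### Counting triangles by the levels of their edges -/

/-- Edges of different clusters whose sums have the same level are strictly nested. -/
theorem nested_of_level_eq {f : ℝ → ℕ} (hf : Monotone f) {u v u' v' : ℝ}
    (h : f (u + v) = f (u' + v')) (h₁ : f (u + v') ≠ f (u + v)) (h₂ : f (u' + v) ≠ f (u + v)) :
    (u < u' ∧ v' < v ∧ f (u + v') < f (u + v) ∧ f (u + v) < f (u' + v)) ∨
      (u' < u ∧ v < v' ∧ f (u' + v) < f (u + v) ∧ f (u + v) < f (u + v')) := by
  rcases lt_or_gt_of_ne h₁ with h₃ | h₃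
  · have a := hf.reflect_lt h₃
    have b := hf.reflect_lt (h ▸ h₃)
    have c := hf (show u + v ≤ u' + v by linarith)
    exact Or.inl ⟨by linarith, by linarith, h₃, lt_of_le_of_ne c h₂.symm⟩
  · have a := hf.reflect_lt h₃
    have b := hf.reflect_lt (show f (u' + v') < f (u + v') from h ▸ h₃)
    have c := hf (show u' + v ≤ u + v by linarith)
    exact Or.inr ⟨by linarith, by linarith, lt_of_le_of_ne c h₂, h₃⟩

section Clusters

variable {ι : Type*} {f : ℝ → ℕ} {k : ℕ} {P : ℕ → Prop}

/-- At most one cluster has an edge at each of the two extreme levels. -/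
theorem card_le_of_extreme_level [DecidablePred P] (hf : Monotone f) (hk : ∀ x, f x ≤ k) (s : Finset ι) (u v : ι → ℝ)
    (hin : ∀ i ∈ s, P (f (u i + v i)))
    (hout : ∀ i j, i ≠ j → ¬ P (f (u i + v j)))
    (hs : ∀ i ∈ s, f (u i + v i) = 0 ∨ f (u i + v i) = k) :
    s.card ≤ (({0, k} : Finset ℕ).filter P).card := by
  -- Two edges on one level force a cross sum strictly below it and another strictly above it;
  -- neither level `0` nor level `k` leaves room for both.
  refine Finset.card_le_card_of_injOn (fun i => f (u i + v i)) ?_ ?_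
  · intro i hi
    have := hs i hi
    simpa using ⟨this, hin i hi⟩
  · intro i hi j hj hij
    by_contra hne
    have h₁ : f (u i + v j) ≠ f (u i + v i) := fun h => hout i j hne (h ▸ hin i hi)
    have h₂ : f (u j + v i) ≠ f (u i + v i) := fun h => hout j i (Ne.symm hne) (h ▸ hin i hi)
    have := hs i hi
    have := hk (u i + v j)
    have := hk (u j + v i)
    rcases nested_of_level_eq hf hij h₁ h₂ with h | h <;> omega

variable {a b c : ι → ℝ}

/-- The data of disjoint triangles with sorted ranks `a ≤ b ≤ c`: the level of every edge of a
triangle satisfies `P`, and no level between two triangles does. -/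
structure TriangleSystem (f : ℝ → ℕ) (P : ℕ → Prop) (a b c : ι → ℝ) : Prop where
  mono : Monotone f
  le₁ : ∀ i, a i ≤ b i
  le₂ : ∀ i, b i ≤ c i
  hab : ∀ i, P (f (a i + b i))
  hac : ∀ i, P (f (a i + c i))
  hbc : ∀ i, P (f (b i + c i))
  out : ∀ i j, i ≠ j → ∀ x ∈ ({a i, b i, c i} : Set ℝ), ∀ y ∈ ({a j, b j, c j} : Set ℝ),
    ¬ P (f (x + y))

/-- The level to which a triangle with two edges of equal level is charged. -/
def chargedLevel (f : ℝ → ℕ) (a b c : ℝ) : ℕ :=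
  if f (a + b) = f (a + c) then f (b + c) else f (a + b)

/-- If two edges from a common vertex have equal level, a foreign rank strictly between their other
ends would give a sum squeezed onto that level. The edge joining those ends, which carries the
charged level, thus has no foreign rank strictly inside, whereas two edges on one level would be
nested. -/
theorem TriangleSystem.chargedLevel_injOn (h : TriangleSystem f P a b c) {i j : ι} (hij : i ≠ j)
    (hi : f (a i + b i) = f (a i + c i) ∨ f (a i + c i) = f (b i + c i))
    (hj : f (a j + b j) = f (a j + c j) ∨ f (a j + c j) = f (b j + c j)) :
    chargedLevel f (a i) (b i) (c i) ≠ chargedLevel f (a j) (b j) (c j) := by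
  -- a triangle has an edge at its charged level with no other rank strictly inside
  have key : ∀ i, (f (a i + b i) = f (a i + c i) ∨ f (a i + c i) = f (b i + c i)) →
      ∃ x ∈ ({a i, b i, c i} : Set ℝ), ∃ y ∈ ({a i, b i, c i} : Set ℝ),
        x ≤ y ∧ f (x + y) = chargedLevel f (a i) (b i) (c i) ∧ P (f (x + y)) ∧
        ∀ j, i ≠ j → ∀ z ∈ ({a j, b j, c j} : Set ℝ), ¬ (x < z ∧ z < y) := by
    intro i hi
    by_cases hl : f (a i + b i) = f (a i + c i)
    · refine ⟨b i, by simp, c i, by simp, h.le₂ i, by simp [chargedLevel, hl], h.hbc i, ?_⟩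
      rintro j hij z hz ⟨h₁, h₂⟩
      have e₁ := h.mono (show a i + b i ≤ a i + z by linarith)
      have e₂ := h.mono (show a i + z ≤ a i + c i by linarith)
      have e : f (a i + z) = f (a i + b i) := by omega
      exact h.out i j hij (a i) (by simp) z hz (e ▸ h.hab i)
    · have hr := hi.resolve_left hl
      refine ⟨a i, by simp, b i, by simp, h.le₁ i, by simp [chargedLevel, hl], h.hab i, ?_⟩
      rintro j hij z hz ⟨h₁, h₂⟩
      have e₁ := h.mono (show a i + c i ≤ c i + z by linarith)
      have e₂ := h.mono (show c i + z ≤ b i + c i by linarith)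
      have e : f (c i + z) = f (a i + c i) := by omega
      exact h.out i j hij (c i) (by simp) z hz (e ▸ h.hac i)
  obtain ⟨x, hx, y, hy, l, e, p, n⟩ := key i hi
  obtain ⟨x', hx', y', hy', l', e', p', n'⟩ := key j hj
  intro heq
  have n₁ := n j hij x' hx'
  have n₂ := n' i hij.symm x hx
  have h₁ : f (x + y') ≠ f (x + y) := fun q => h.out i j hij x hx y' hy' (q ▸ p)
  have h₂ : f (x' + y) ≠ f (x + y) := fun q => h.out j i hij.symm x' hx' y hy (q ▸ p)
  have h₃ : f (x + x') ≠ f (x + y) := fun q => h.out i j hij x hx x' hx' (q ▸ p)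
  have h₄ : f (y' + y) ≠ f (x + y) := fun q => h.out j i hij.symm y' hy' y hy (q ▸ p)
  have e₁ : f (x + y) = f (x' + y') := by rw [e, e', heq]
  -- Nesting is applied to both orderings of the second edge; together they put an end of one edge
  -- strictly inside the other.
  have e₂ : f (x + y) = f (y' + x') := by rw [add_comm y' x', e₁]
  rcases nested_of_level_eq h.mono e₁ h₁ h₂ with g | g <;>
  rcases nested_of_level_eq h.mono e₂ h₃ h₄ with g' | g'
  · exact n₁ ⟨g.1, g'.2.1⟩
  · linarith [g'.1, g'.2.1]
  · exact n₂ ⟨g.1, g'.1⟩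
  · linarith [g.2.1, g'.1]

/-- For distinct triangles, nesting makes the differences of the `a`-, `b`- and `c`-ranks pairwise
opposite in sign, which is impossible for three reals. -/
theorem TriangleSystem.eq_of_levels_eq (h : TriangleSystem f P a b c) {i j : ι}
    (hab : f (a i + b i) = f (a j + b j)) (hac : f (a i + c i) = f (a j + c j))
    (hbc : f (b i + c i) = f (b j + c j)) : i = j := by
  by_contra hij
  have o : ∀ x ∈ ({a i, b i, c i} : Set ℝ), ∀ y ∈ ({a j, b j, c j} : Set ℝ), ∀ z, P (f z) →
      f (x + y) ≠ f z := fun x hx y hy z hz q => h.out i j hij x hx y hy (q ▸ hz)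
  have o' : ∀ x ∈ ({a i, b i, c i} : Set ℝ), ∀ y ∈ ({a j, b j, c j} : Set ℝ), ∀ z, P (f z) →
      f (y + x) ≠ f z := fun x hx y hy z hz => add_comm x y ▸ o x hx y hy z hz
  have n₁ := nested_of_level_eq h.mono hab (o _ (by simp) _ (by simp) _ (h.hab i))
    (o' _ (by simp) _ (by simp) _ (h.hab i))
  have n₂ := nested_of_level_eq h.mono hac (o _ (by simp) _ (by simp) _ (h.hac i))
    (o' _ (by simp) _ (by simp) _ (h.hac i))
  have n₃ := nested_of_level_eq h.mono hbc (o _ (by simp) _ (by simp) _ (h.hbc i))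
    (o' _ (by simp) _ (by simp) _ (h.hbc i))
  rcases n₁ with n₁ | n₁ <;> rcases n₂ with n₂ | n₂ <;> rcases n₃ with n₃ | n₃ <;>
    linarith [n₁.1, n₁.2.1, n₂.1, n₂.2.1, n₃.1, n₃.2.1]

/-- The bound on the number of triangles in terms of the numbers of extreme and inner levels. -/
theorem TriangleSystem.card_le [Fintype ι] [DecidablePred P] (h : TriangleSystem f P a b c) (hk : ∀ x, f x ≤ k) :
    Fintype.card ι ≤ (({0, k} : Finset ℕ).filter P).card +
      (((Finset.Ioo 0 k).filter P).card + ((Finset.Ioo 0 k).filter P).card.choose 3) := by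
  classical
  let ext : ι → Prop := fun i => (f (a i + b i) = 0 ∨ f (a i + b i) = k) ∨
    (f (a i + c i) = 0 ∨ f (a i + c i) = k) ∨ (f (b i + c i) = 0 ∨ f (b i + c i) = k)
  let eqv : ι → Prop := fun i =>
    f (a i + b i) = f (a i + c i) ∨ f (a i + c i) = f (b i + c i)
  have hinner : ∀ i, ¬ ext i → f (a i + b i) ∈ (Finset.Ioo 0 k).filter P ∧
      f (a i + c i) ∈ (Finset.Ioo 0 k).filter P ∧ f (b i + c i) ∈ (Finset.Ioo 0 k).filter P := by
    intro i hi
    simp only [ext, not_or] at hi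
    obtain ⟨⟨h₁, h₂⟩, ⟨h₃, h₄⟩, h₅, h₆⟩ := hi
    have := hk (a i + b i)
    have := hk (a i + c i)
    have := hk (b i + c i)
    simp only [Finset.mem_filter, Finset.mem_Ioo]
    exact ⟨⟨by omega, h.hab i⟩, ⟨by omega, h.hac i⟩, ⟨by omega, h.hbc i⟩⟩
  have hA : (Finset.univ.filter ext).card ≤ (({0, k} : Finset ℕ).filter P).card := by
    have : ∀ i, ∃ u ∈ ({a i, b i, c i} : Set ℝ), ∃ v ∈ ({a i, b i, c i} : Set ℝ),
        P (f (u + v)) ∧ (ext i → f (u + v) = 0 ∨ f (u + v) = k) := by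
      intro i
      by_cases h₁ : f (a i + b i) = 0 ∨ f (a i + b i) = k
      · exact ⟨a i, by simp, b i, by simp, h.hab i, fun _ => h₁⟩
      by_cases h₂ : f (a i + c i) = 0 ∨ f (a i + c i) = k
      · exact ⟨a i, by simp, c i, by simp, h.hac i, fun _ => h₂⟩
      exact ⟨b i, by simp, c i, by simp, h.hbc i, fun h₃ =>
        (h₃.resolve_left h₁).resolve_left h₂⟩
    choose u hu v hv hP hext using this
    exact card_le_of_extreme_level h.mono hk _ u v (fun i _ => hP i)
      (fun i j hij => h.out i j hij _ (hu i) _ (hv j)) (fun i hi => hext i (by simpa using hi))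
  have hB : (Finset.univ.filter (fun i => ¬ ext i ∧ eqv i)).card ≤
      ((Finset.Ioo 0 k).filter P).card := by
    refine Finset.card_le_card_of_injOn (fun i => chargedLevel f (a i) (b i) (c i)) ?_ ?_
    · intro i hi
      have hi' := hinner i (by simpa using (Finset.mem_filter.1 hi).2.1)
      simp only [chargedLevel]
      split_ifs
      · exact hi'.2.2
      · exact hi'.1
    · intro i hi j hj hij
      by_contra hne
      exact h.chargedLevel_injOn hne (Finset.mem_filter.1 hi).2.2 (Finset.mem_filter.1 hj).2.2 hij
  have hC : (Finset.univ.filter (fun i => ¬ ext i ∧ ¬ eqv i)).card ≤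
      ((Finset.Ioo 0 k).filter P).card.choose 3 := by
    rw [← Finset.card_powersetCard]
    have hlt : ∀ i, ¬ eqv i → f (a i + b i) < f (a i + c i) ∧ f (a i + c i) < f (b i + c i) := by
      intro i hi
      simp only [eqv, not_or] at hi
      have h₁ := h.le₁ i
      have h₂ := h.le₂ i
      exact ⟨lt_of_le_of_ne (h.mono (by linarith)) hi.1, lt_of_le_of_ne (h.mono (by linarith)) hi.2⟩
    -- The three levels increase strictly, so their set recovers which edge has which level.
    refine Finset.card_le_card_of_injOn
      (fun i => {f (a i + b i), f (a i + c i), f (b i + c i)}) ?_ ?_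
    · intro i hi
      have hi := (Finset.mem_filter.1 hi).2
      have hi' := hinner i hi.1
      obtain ⟨l₁, l₂⟩ := hlt i hi.2
      rw [Finset.mem_coe, Finset.mem_powersetCard]
      refine ⟨?_, Finset.card_eq_three.2 ⟨_, _, _, l₁.ne, (l₁.trans l₂).ne, l₂.ne, rfl⟩⟩
      intro x hx
      simp only [Finset.mem_insert, Finset.mem_singleton] at hx
      rcases hx with rfl | rfl | rfl
      exacts [hi'.1, hi'.2.1, hi'.2.2]
    · intro i hi j hj hij
      obtain ⟨l₁, l₂⟩ := hlt i (Finset.mem_filter.1 hi).2.2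
      obtain ⟨l₃, l₄⟩ := hlt j (Finset.mem_filter.1 hj).2.2
      have hij : ({f (a i + b i), f (a i + c i), f (b i + c i)} : Finset ℕ) =
        {f (a j + b j), f (a j + c j), f (b j + c j)} := hij
      simp only [Finset.ext_iff, Finset.mem_insert, Finset.mem_singleton] at hij
      have m₁ := (hij (f (a i + b i))).1 (by simp)
      have m₂ := (hij (f (a i + c i))).1 (by simp)
      have m₃ := (hij (f (b i + c i))).1 (by simp)
      exact h.eq_of_levels_eq (by omega) (by omega) (by omega)
  have hcover : (Finset.univ : Finset ι) = Finset.univ.filter ext ∪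
      (Finset.univ.filter (fun i => ¬ ext i ∧ eqv i) ∪
        Finset.univ.filter (fun i => ¬ ext i ∧ ¬ eqv i)) := by
    ext i
    simp only [Finset.mem_univ, Finset.mem_union, Finset.mem_filter, true_and, true_iff]
    tauto
  calc Fintype.card ι = (Finset.univ : Finset ι).card := rfl
    _ ≤ _ := by
      rw [hcover]
      exact (Finset.card_union_le _ _).trans (add_le_add hA
        ((Finset.card_union_le _ _).trans (add_le_add hB hC)))

end Clusters

/-! ### Bounds for the two families of graphs -/

/-- The number of thresholds up to `x`. -/
noncomputable def level (θ : Finset ℝ) (x : ℝ) : ℕ := (θ.filter (fun t => t ≤ x)).card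

theorem level_mono (θ : Finset ℝ) : Monotone (level θ) := fun _ _ h =>
  Finset.card_le_card (Finset.monotone_filter_right _ fun _ _ ht => ht.trans h)

theorem level_le (θ : Finset ℝ) (x : ℝ) : level θ x ≤ θ.card := Finset.card_filter_le _ _

section Bounds

variable {n₁ n₂ n₃ : ℕ} {f : ℝ → ℕ} {k : ℕ} {P : ℕ → Prop} [DecidablePred P]
  {r : (Σ i : Fin n₁ ⊕ Fin n₂ ⊕ Fin n₃, Fin (partSize n₁ n₂ n₃ i)) → ℝ}

/-- The number of clusters of size `3` is bounded by the numbers of extreme and inner levels. -/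
theorem card_parts_three_le (hf : Monotone f) (hk : ∀ x, f x ≤ k)
    (hr : ∀ u v, u ≠ v → (u.1 = v.1 ↔ P (f (r u + r v)))) :
    n₃ ≤ (({0, k} : Finset ℕ).filter P).card +
      (((Finset.Ioo 0 k).filter P).card + ((Finset.Ioo 0 k).filter P).card.choose 3) := by
  let t : Fin n₃ → Fin 3 → ℝ := fun i j => r ⟨Sum.inr (Sum.inr i), j⟩
  let s : Fin n₃ → Equiv.Perm (Fin 3) := fun i => Tuple.sort (t i)
  have hs : ∀ i, Monotone (t i ∘ s i) := fun i => Tuple.monotone_sort (t i)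
  have hin : ∀ i j j', j ≠ j' → P (f (t i (s i j) + t i (s i j'))) := by
    intro i j j' hj
    refine (hr _ _ fun h => hj ((s i).injective ?_)).1 rfl
    exact eq_of_heq (Sigma.mk.inj h).2
  have hout : ∀ i i', i ≠ i' → ∀ j j', ¬ P (f (t i j + t i' j')) := by
    intro i i' hi j j' hP
    have hne : (Sum.inr (Sum.inr i) : Fin n₁ ⊕ Fin n₂ ⊕ Fin n₃) ≠ Sum.inr (Sum.inr i') := by
      simpa using hi
    exact hne ((hr ⟨Sum.inr (Sum.inr i), j⟩ ⟨Sum.inr (Sum.inr i'), j'⟩ fun h => hne (congrArg Sigma.fst h)).2 hP)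
  have h : TriangleSystem f P (fun i => t i (s i 0)) (fun i => t i (s i 1))
      (fun i => t i (s i 2)) :=
    { mono := hf
      le₁ := fun i => hs i (by decide)
      le₂ := fun i => hs i (by decide)
      hab := fun i => hin i _ _ (by decide)
      hac := fun i => hin i _ _ (by decide)
      hbc := fun i => hin i _ _ (by decide)
      out := by
        intro i j hij x hx y hy
        simp only [Set.mem_insert_iff, Set.mem_singleton_iff] at hx hy
        rcases hx with rfl | rfl | rfl <;> rcases hy with rfl | rfl | rfl <;>
          exact hout i j hij _ _ }
  simpa using h.card_le hk

/-- Without inner levels there are few clusters of size at least `2`. -/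
theorem card_parts_two_three_le (hf : Monotone f) (hk : ∀ x, f x ≤ k)
    (hr : ∀ u v, u ≠ v → (u.1 = v.1 ↔ P (f (r u + r v))))
    (hP : ∀ l, 0 < l → l < k → ¬ P l) :
    n₂ + n₃ ≤ (({0, k} : Finset ℕ).filter P).card := by
  have hsz : ∀ i : Fin n₂ ⊕ Fin n₃, 2 ≤ partSize n₁ n₂ n₃ (Sum.inr i) := by
    rintro (i | i) <;> simp [partSize]
  let u : Fin n₂ ⊕ Fin n₃ → ℝ := fun i => r ⟨Sum.inr i, ⟨0, by have := hsz i; omega⟩⟩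
  let v : Fin n₂ ⊕ Fin n₃ → ℝ := fun i => r ⟨Sum.inr i, ⟨1, by have := hsz i; omega⟩⟩
  have hin : ∀ i, P (f (u i + v i)) := fun i => (hr _ _ fun h => by
    simpa using eq_of_heq (Sigma.mk.inj h).2).1 rfl
  have hout : ∀ i j, i ≠ j → ¬ P (f (u i + v j)) := by
    intro i j hij h
    have hne : (Sum.inr i : Fin n₁ ⊕ Fin n₂ ⊕ Fin n₃) ≠ Sum.inr j := by simpa using hij
    exact hne ((hr ⟨_, _⟩ ⟨_, _⟩ fun h => hne (congrArg Sigma.fst h)).2 h)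
  have := card_le_of_extreme_level hf hk Finset.univ u v (fun i _ => hin i) hout (fun i _ => by
    by_contra hne
    rw [not_or] at hne
    have := hk (u i + v i)
    exact hP _ (by omega) (by omega) (hin i))
  simpa using this

/-- Pairs in one part have even level. With `2 * m + 1` thresholds there are `m` even inner levels
and the extreme level `0`; with `2 * m + 2`, again `m` inner ones and both extremes. If `m = 0`,
parts of size `2` also need an extreme level. -/
theorem multipartite123_bounds {k : ℕ} (hn : 2 ≤ n₁ + n₂ + n₃)
    (h : IsKThreshold (multipartite123 n₁ n₂ n₃) k) :
    (∃ m, k = 2 * m + 1 ∧ n₃ ≤ m + m.choose 3 + 1 ∧ (m = 0 → n₂ + n₃ ≤ 1)) ∨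
      (∃ m, k = 2 * m + 2 ∧ n₃ ≤ m + m.choose 3 + 2 ∧ (m = 0 → n₂ + n₃ ≤ 2)) := by
  obtain ⟨θ, rfl, r, hr⟩ := h
  have hr' : ∀ u v, u ≠ v → (u.1 = v.1 ↔ Even (level θ (r u + r v))) := by
    intro u v huv
    have := hr u v huv
    simp only [multipartite123, SimpleGraph.completeMultipartiteGraph] at this
    rw [← Nat.not_odd_iff_even, level, ← this]
    simp
  have b₁ := card_parts_three_le (level_mono θ) (level_le θ) hr'
  have b₂ := card_parts_two_three_le (level_mono θ) (level_le θ) hr'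
  have hin : ∀ m, θ.card ≤ 2 * m + 2 → ((Finset.Ioo 0 θ.card).filter Even).card ≤ m := by
    intro m hm
    calc _ ≤ ((Finset.range m).image fun i => 2 * i + 2).card := by
          refine Finset.card_le_card fun x hx => ?_
          simp only [Finset.mem_filter, Finset.mem_Ioo] at hx
          obtain ⟨⟨h₁, h₂⟩, y, rfl⟩ := hx
          exact Finset.mem_image.2 ⟨y - 1, by simp; omega, by omega⟩
      _ ≤ m := Finset.card_image_le.trans (by simp)
  rcases Nat.even_or_odd' θ.card with ⟨m, hm | hm⟩
  · rcases m with _ | m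
    -- Without thresholds every level is `0`, hence even, so there would be only one part.
    · exfalso
      have : ∀ u v : (Σ i : Fin n₁ ⊕ Fin n₂ ⊕ Fin n₃, Fin (partSize n₁ n₂ n₃ i)),
          u.1 = v.1 := by
        intro u v
        by_cases huv : u = v
        · rw [huv]
        · refine (hr' u v huv).2 ?_
          have := level_le θ (r u + r v)
          rw [show level θ (r u + r v) = 0 by omega]
          exact Even.zero
      have hsz : ∀ i, 0 < partSize n₁ n₂ n₃ i := by
        rintro (i | i | i) <;> simp [partSize]
      have : Subsingleton (Fin n₁ ⊕ Fin n₂ ⊕ Fin n₃) :=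
        ⟨fun i j => this ⟨i, ⟨0, hsz i⟩⟩ ⟨j, ⟨0, hsz j⟩⟩⟩
      have := Fintype.card_le_one_iff_subsingleton.2 this
      simp at this
      omega
    · have h₁ := hin m (by omega)
      have h₂ := Nat.choose_le_choose 3 h₁
      have h₃ : (({0, θ.card} : Finset ℕ).filter Even).card ≤ 2 :=
        (Finset.card_filter_le _ _).trans Finset.card_le_two
      refine Or.inr ⟨m, by omega, by omega, ?_⟩
      rintro rfl
      exact (b₂ fun l hl hl' hl'' => by obtain ⟨y, rfl⟩ := hl''; omega).trans h₃
  · have h₁ := hin m (by omega)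
    have h₂ := Nat.choose_le_choose 3 h₁
    have h₃ : (({0, θ.card} : Finset ℕ).filter Even).card ≤ 1 := by
      rw [Finset.filter_insert, Finset.filter_singleton]
      simp [hm]
    refine Or.inl ⟨m, by omega, by omega, ?_⟩
    rintro rfl
    exact (b₂ fun l hl hl' hl'' => by omega).trans h₃

/-- Here odd levels count: `0` never qualifies, and the top level does exactly when the number of
thresholds is odd. -/
theorem cluster123_bounds {k : ℕ} (h : IsKThreshold (cluster123 n₁ n₂ n₃) k) :
    (∃ m, k = 2 * m ∧ n₃ ≤ m + m.choose 3 ∧ (m = 0 → n₂ + n₃ ≤ 0)) ∨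
      (∃ m, k = 2 * m + 1 ∧ n₃ ≤ m + m.choose 3 + 1 ∧ (m = 0 → n₂ + n₃ ≤ 1)) := by
  obtain ⟨θ, rfl, r, hr⟩ := h
  have hr' : ∀ u v, u ≠ v → (u.1 = v.1 ↔ Odd (level θ (r u + r v))) := by
    intro u v huv
    rw [level, ← hr u v huv]
    simp [cluster123, huv]
  have b₁ := card_parts_three_le (level_mono θ) (level_le θ) hr'
  have b₂ := card_parts_two_three_le (level_mono θ) (level_le θ) hr'
  have hin : ∀ m, θ.card ≤ 2 * m + 1 → ((Finset.Ioo 0 θ.card).filter Odd).card ≤ m := by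
    intro m hm
    calc _ ≤ ((Finset.range m).image fun i => 2 * i + 1).card := by
          refine Finset.card_le_card fun x hx => ?_
          simp only [Finset.mem_filter, Finset.mem_Ioo] at hx
          obtain ⟨⟨h₁, h₂⟩, y, rfl⟩ := hx
          exact Finset.mem_image.2 ⟨y, by simp; omega, by omega⟩
      _ ≤ m := Finset.card_image_le.trans (by simp)
  rcases Nat.even_or_odd' θ.card with ⟨m, hm | hm⟩
  · have h₁ := hin m (by omega)
    have h₂ := Nat.choose_le_choose 3 h₁
    have h₃ : (({0, θ.card} : Finset ℕ).filter Odd).card ≤ 0 := by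
      rw [Finset.filter_insert, Finset.filter_singleton]
      simp [hm]
    refine Or.inl ⟨m, by omega, by omega, ?_⟩
    rintro rfl
    exact (b₂ fun l hl hl' hl'' => by omega).trans h₃
  · have h₁ := hin m (by omega)
    have h₂ := Nat.choose_le_choose 3 h₁
    have h₃ : (({0, θ.card} : Finset ℕ).filter Odd).card ≤ 1 := by
      rw [Finset.filter_insert, Finset.filter_singleton]
      simp [hm]
    refine Or.inr ⟨m, by omega, by omega, ?_⟩
    rintro rfl
    exact (b₂ fun l hl hl' hl'' => by omega).trans h₃

end Bounds

/-! ### Isolating finitely many sums by thresholds -/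

/-- A finite set `S` of points is cut out of a finite set `F` by the parity of `2 |S|` thresholds. -/
theorem exists_thresholds_of_finset (F S : Finset ℝ) :
    ∃ D : Finset ℝ, D.card = 2 * S.card ∧ (∀ d ∈ D, d ∈ F → d ∈ S) ∧
      ∀ x ∈ F, Odd (level D x) ↔ x ∈ S := by
  classical
  -- With `ε` below every gap of `F ∪ S`, the thresholds `s` and `s + ε` enclose no point of `F ∪ S`
  -- but `s`.
  have hε : ∀ᶠ ε in nhdsWithin (0 : ℝ) (Set.Ioi 0), ∀ x ∈ F ∪ S, ∀ y ∈ F ∪ S, x < y →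
      x + ε < y := by
    rw [Filter.eventually_all_finset]
    intro x _
    rw [Filter.eventually_all_finset]
    intro y _
    by_cases hxy : x < y
    · have := Ioo_mem_nhdsGT (sub_pos.2 hxy)
      filter_upwards [this] with ε hε _
      linarith [hε.2]
    · exact Filter.Eventually.of_forall fun _ h => absurd h hxy
  obtain ⟨ε, hlt, hpos⟩ := (hε.and self_mem_nhdsWithin).exists
  replace hpos : 0 < ε := hpos
  have hadd : ∀ s ∈ S, ∀ x ∈ F ∪ S, (s + ε ≤ x ↔ s < x) := fun s hs x hx =>
    ⟨fun h => by linarith, fun h => (hlt s (Finset.mem_union_right _ hs) x hx h).le⟩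
  have hnotin : ∀ s ∈ S, s + ε ∉ F ∪ S := fun s hs h =>
    lt_irrefl _ (hlt s (Finset.mem_union_right _ hs) _ h (by linarith))
  have hdisj : Disjoint S (S.image (· + ε)) := by
    rw [Finset.disjoint_left]
    intro s hs h
    obtain ⟨t, ht, rfl⟩ := Finset.mem_image.1 h
    exact hnotin t ht (Finset.mem_union_right _ hs)
  refine ⟨S ∪ S.image (· + ε), ?_, ?_, ?_⟩
  · rw [Finset.card_union_of_disjoint hdisj,
      Finset.card_image_of_injective _ (add_left_injective ε), two_mul]
  · intro d hd hF
    rcases Finset.mem_union.1 hd with h | h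
    · exact h
    · obtain ⟨s, hs, rfl⟩ := Finset.mem_image.1 h
      exact absurd (Finset.mem_union_left _ hF) (hnotin s hs)
  · intro x hx
    have hcard : ((S.image (· + ε)).filter (fun t => t ≤ x)).card =
        (S.filter (fun t => t < x)).card := by
      rw [Finset.filter_image, Finset.card_image_of_injective _ (add_left_injective ε)]
      exact congrArg _ (Finset.filter_congr fun s hs => hadd s hs x (Finset.mem_union_left _ hx))
    have hle : (S.filter (fun t => t ≤ x)).card =
        (S.filter (fun t => t < x)).card + if x ∈ S then 1 else 0 := by
      have : S.filter (fun t => t ≤ x) = S.filter (fun t => t < x) ∪ S.filter (fun t => t = x) := by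
        ext t
        simp [le_iff_lt_or_eq, and_or_left]
      rw [this, Finset.card_union_of_disjoint, Finset.filter_eq']
      · split_ifs <;> simp
      · exact Finset.disjoint_filter.2 fun t _ h h' => h.ne h'
    rw [level, Finset.filter_union,
      Finset.card_union_of_disjoint (Finset.disjoint_filter_filter hdisj), hcard, hle]
    split_ifs with h
    · simp only [h, iff_true]
      exact ⟨_, by ring⟩
    · simp only [h, iff_false, add_zero, Nat.not_odd_iff_even]
      exact ⟨_, rfl⟩

/-- A new threshold flips the parity of exactly the sums from it on. -/
theorem odd_level_insert {D : Finset ℝ} {B : ℝ} (hB : B ∉ D) (x : ℝ) :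
    Odd (level (insert B D) x) ↔ (Odd (level D x) ↔ ¬ B ≤ x) := by
  classical
  rw [level, Finset.filter_insert]
  split_ifs with h
  · rw [Finset.card_insert_of_notMem (by simp [hB]), Nat.odd_add_one]
    simp [h, level]
  · simp [h, level]

/-! ### The generic configuration in rational coordinates -/

section Vectors

variable {m n₁ n₂ : ℕ}

/-- The generic clusters: singletons, pairs, triangles around a centre, and triangles spanned by
three centres. -/
abbrev Slot (m n₁ n₂ : ℕ) : Type :=
  Fin n₁ ⊕ Fin n₂ ⊕ Fin m ⊕ {T : Finset (Fin m) // T.card = 3}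

/-- The number of vertices of a generic cluster. -/
def Slot.size : Slot m n₁ n₂ → ℕ
  | .inl _ => 1
  | .inr (.inl _) => 2
  | .inr (.inr _) => 3

/-- The coordinates of the ranks in the generic configuration, where the pair `i` is centred at
`z i`. -/
def slotVec (z : Fin n₂ → Fin m) : Slot m n₁ n₂ → Fin 3 → Fin m ⊕ Fin n₂ ⊕ Fin n₁ → ℚ
  | .inl i, _, .inr (.inr i') => if i = i' then 1 else 0
  | .inl _, _, .inr (.inl _) => 0
  | .inl _, _, .inl _ => 0
  | .inr (.inl _), _, .inr (.inr _) => 0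
  | .inr (.inl i), a, .inr (.inl i') => if i = i' then (if a = 0 then 1 else -1) else 0
  | .inr (.inl i), _, .inl l => if z i = l then 1 / 2 else 0
  | .inr (.inr (.inl _)), _, .inr _ => 0
  | .inr (.inr (.inl c)), _, .inl l => if c = l then 1 / 2 else 0
  | .inr (.inr (.inr _)), _, .inr _ => 0
  | .inr (.inr (.inr T)), a, .inl l =>
      if l ∈ T.1 then (if l = T.1.orderEmbOfFin T.2 a then -(1 / 2) else 1 / 2) else 0

/-- The coordinates of the threshold of the centre `l`. -/
def centreVec (n₁ n₂ : ℕ) (l : Fin m) : Fin m ⊕ Fin n₂ ⊕ Fin n₁ → ℚ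
  | .inl l' => if l = l' then 1 else 0
  | .inr _ => 0

theorem centreVec_injective : Function.Injective (centreVec (m := m) n₁ n₂) := by
  intro l l' h
  have := congrFun h (.inl l')
  by_contra hne
  simp [centreVec, hne] at this

variable (z : Fin n₂ → Fin m)

theorem slotVec_add_of_fst_eq (i : Slot m n₁ n₂) {a b : Fin 3} (ha : (a : ℕ) < i.size)
    (hb : (b : ℕ) < i.size) (hab : a ≠ b) :
    ∃ l, slotVec z i a + slotVec z i b = centreVec n₁ n₂ l := by
  rcases i with i | i | i | T
  · simp only [Slot.size] at ha hb
    exact absurd (Fin.ext (by omega)) hab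
  · simp only [Slot.size] at ha hb
    refine ⟨z i, funext fun x => ?_⟩
    rcases x with x | x | x
    · simp only [Pi.add_apply, slotVec, centreVec]
      split_ifs <;> norm_num
    · simp only [Pi.add_apply, slotVec, centreVec]
      split_ifs with h₁ h₂ h₃ h₃ <;> try norm_num
      · exact hab (h₂.trans h₃.symm)
      · exact hab (Fin.ext (by have := Fin.val_ne_of_ne h₂; have := Fin.val_ne_of_ne h₃
                               simp at *; omega))
    · simp [slotVec, centreVec]
  · refine ⟨i, funext fun x => ?_⟩
    rcases x with x | x
    · simp only [Pi.add_apply, slotVec, centreVec]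
      split_ifs <;> norm_num
    · simp [slotVec, centreVec]
  · obtain ⟨c, hca, hcb⟩ : ∃ c : Fin 3, c ≠ a ∧ c ≠ b := by
      clear ha hb hab
      revert a b; decide
    have hcover : ∀ d : Fin 3, d = a ∨ d = b ∨ d = c := by
      clear ha hb
      revert a b c; decide
    -- Each vertex of a triple's triangle negates one centre; two of them add up to the centre
    -- negated by the third vertex `c`.
    refine ⟨T.1.orderEmbOfFin T.2 c, funext fun x => ?_⟩
    rcases x with x | x
    · simp only [Pi.add_apply, slotVec, centreVec]
      by_cases hx : x ∈ T.1
      · obtain ⟨d, rfl⟩ : ∃ d, T.1.orderEmbOfFin T.2 d = x := by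
          rwa [← Set.mem_range, Finset.range_orderEmbOfFin T.1 T.2]
        simp only [hx, if_true, (T.1.orderEmbOfFin T.2).injective.eq_iff]
        rcases hcover d with rfl | rfl | rfl
        · simp [hab, hca]
        · simp [hab.symm, hcb]
        · simp [hca, hcb]; norm_num
      · have : T.1.orderEmbOfFin T.2 c ≠ x := fun h => hx (h ▸ Finset.orderEmbOfFin_mem _ _ _)
        simp [hx, this]
    · simp [slotVec, centreVec]

/-- Triples with two vertices whose coordinates add up to a centre coincide. -/
theorem triple_subset_of_add_eq {T T' : {T : Finset (Fin m) // T.card = 3}} {a b : Fin 3} {l : Fin m}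
    (h : slotVec z (.inr (.inr (.inr T)) : Slot m n₁ n₂) a +
      slotVec z (.inr (.inr (.inr T'))) b = centreVec n₁ n₂ l) : T.1 ⊆ T'.1 := by
  intro x hx
  have h₁ := congrFun h (.inl x)
  by_contra hx'
  simp only [Pi.add_apply, slotVec, centreVec, hx, hx', if_true, if_false] at h₁
  split_ifs at h₁ <;> norm_num at h₁

/-- The private coordinate of a singleton or pair cannot cancel against another cluster. Two
different triangles have different supports, so some centre coordinate of the sum is `1 / 2` or `-1
/ 2`, not an integer. -/
theorem eq_of_slotVec_add_eq {i j : Slot m n₁ n₂} {a b : Fin 3} {l : Fin m}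
    (h : slotVec z i a + slotVec z j b = centreVec n₁ n₂ l) : i = j := by
  have hc := fun x => congrFun h x
  simp only [Pi.add_apply] at hc
  -- a triple and a centre
  have key : ∀ (c : Fin m) (T : {T : Finset (Fin m) // T.card = 3}) (a b : Fin 3),
      slotVec z (.inr (.inr (.inl c)) : Slot m n₁ n₂) a +
        slotVec z (.inr (.inr (.inr T))) b ≠ centreVec n₁ n₂ l := by
    intro c T a b h
    obtain ⟨x, hx, hne⟩ := Finset.exists_mem_ne (s := T.1) (by rw [T.2]; norm_num) c
    have h₁ := congrFun h (.inl x)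
    simp only [Pi.add_apply, slotVec, centreVec, hx, hne.symm, if_true, if_false] at h₁
    split_ifs at h₁ <;> norm_num at h₁
  rcases i with i | i | i | T <;> rcases j with j | j | j | T'
  · have := hc (.inr (.inr i))
    by_contra hne
    have hne' : j ≠ i := fun h => hne (by rw [h])
    simp [slotVec, centreVec, hne'] at this
  · have := hc (.inr (.inr i))
    simp [slotVec, centreVec] at this
  · have := hc (.inr (.inr i))
    simp [slotVec, centreVec] at this
  · have := hc (.inr (.inr i))
    simp [slotVec, centreVec] at this
  · have := hc (.inr (.inr j))
    simp [slotVec, centreVec] at this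
  · have := hc (.inr (.inl i))
    by_contra hne
    have hne' : j ≠ i := fun h => hne (by rw [h])
    simp only [slotVec, centreVec, hne', if_true, if_false] at this
    split_ifs at this <;> norm_num at this
  · have := hc (.inr (.inl i))
    simp only [slotVec, centreVec, if_true] at this
    split_ifs at this <;> norm_num at this
  · have := hc (.inr (.inl i))
    simp only [slotVec, centreVec, if_true] at this
    split_ifs at this <;> norm_num at this
  · have := hc (.inr (.inr j))
    simp [slotVec, centreVec] at this
  · have := hc (.inr (.inl j))
    simp only [slotVec, centreVec, if_true] at this
    split_ifs at this <;> norm_num at this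
  · have := hc (.inl i)
    by_contra hne
    have hne' : j ≠ i := fun h => hne (by rw [h])
    simp only [slotVec, centreVec, hne', if_true, if_false] at this
    split_ifs at this <;> norm_num at this
  · exact absurd h (key _ _ _ _)
  · have := hc (.inr (.inr j))
    simp [slotVec, centreVec] at this
  · have := hc (.inr (.inl j))
    simp only [slotVec, centreVec, if_true] at this
    split_ifs at this <;> norm_num at this
  · exact absurd (add_comm _ _ |>.trans h) (key _ _ _ _)
  · have hT : T = T' := Subtype.ext
      (Finset.Subset.antisymm (triple_subset_of_add_eq z h)
        (triple_subset_of_add_eq z (add_comm _ _ |>.trans h)))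
    rw [hT]

end Vectors

/-- A rational coordinate space of finite dimension embeds linearly into the reals. -/
theorem exists_injective_linearMap_real (κ : Type) [Fintype κ] :
    ∃ φ : (κ → ℚ) →ₗ[ℚ] ℝ, Function.Injective φ := by
  rw [← rank_le_iff_exists_linearMap, Real.rank_rat_real]
  exact (Module.rank_lt_aleph0 ℚ (κ → ℚ)).le.trans Cardinal.aleph0_le_continuum

/-- A configuration of `m` sums and clusters of ranks: a sum of ranks is one of the `m` sums if and
only if the two vertices lie in the same cluster. -/
theorem exists_slot_ranks {m n₁ n₂ : ℕ} (z : Fin n₂ → Fin m) :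
    ∃ S : Finset ℝ, S.card = m ∧ ∃ r : Slot m n₁ n₂ → Fin 3 → ℝ,
      ∀ (i j : Slot m n₁ n₂) (a b : Fin 3), (a : ℕ) < i.size → (b : ℕ) < j.size → (i = j → a ≠ b) →
        (r i a + r j b ∈ S ↔ i = j) := by
  classical
  obtain ⟨φ, hφ⟩ := exists_injective_linearMap_real (Fin m ⊕ Fin n₂ ⊕ Fin n₁)
  refine ⟨Finset.univ.image fun l => φ (centreVec n₁ n₂ l), ?_, fun i a => φ (slotVec z i a), ?_⟩
  · exact (Finset.card_image_of_injective _ (hφ.comp centreVec_injective)).trans (by simp)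
  · intro i j a b ha hb hab
    rw [← map_add]
    simp only [Finset.mem_image, Finset.mem_univ, true_and, hφ.eq_iff]
    constructor
    · rintro ⟨l, h⟩
      exact eq_of_slotVec_add_eq z h.symm
    · rintro rfl
      obtain ⟨l, h⟩ := slotVec_add_of_fst_eq z i ha hb (hab rfl)
      exact ⟨l, h.symm⟩

/-! ### Extreme clusters and assembly of the construction -/

/-- The generic configuration together with two clusters of very small and very large ranks. -/
theorem exists_slot_ranks_extended {m n₁ n₂ : ℕ} (z : Fin n₂ → Fin m) :
    ∃ S : Finset ℝ, S.card = m ∧ ∃ A B : ℝ, A < B ∧ (∀ s ∈ S, A < s ∧ s < B) ∧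
      ∃ r : Slot m n₁ n₂ ⊕ Bool → Fin 3 → ℝ,
      ∀ (i j : Slot m n₁ n₂ ⊕ Bool) (a b : Fin 3),
        (a : ℕ) < i.elim Slot.size (fun _ => 3) → (b : ℕ) < j.elim Slot.size (fun _ => 3) →
        (i = j → a ≠ b) →
        (i = j ↔ r i a + r j b ∈ S ∨ r i a + r j b < A ∨ B ≤ r i a + r j b) ∧
        (r i a + r j b < A → i = .inr false) ∧ (B ≤ r i a + r j b → i = .inr true) := by
  obtain ⟨S, hS, r, hr⟩ := exists_slot_ranks (n₁ := n₁) z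
  obtain ⟨R₁, hR₁⟩ := (Set.finite_range fun p : Slot m n₁ n₂ × Fin 3 => |r p.1 p.2|).bddAbove
  obtain ⟨R₂, hR₂⟩ := (S.image fun s => |s|).bddAbove
  obtain ⟨R, hR⟩ : ∃ R, R = max 0 (max R₁ R₂) := ⟨_, rfl⟩
  have h0 : 0 ≤ R := hR ▸ le_max_left _ _
  have h1 : ∀ i a, -R ≤ r i a ∧ r i a ≤ R := fun i a => abs_le.1 <|
    (hR₁ ⟨(i, a), rfl⟩).trans (hR ▸ (le_max_left _ _).trans (le_max_right _ _))
  have h2 : ∀ s ∈ S, -R ≤ s ∧ s ≤ R := fun s hs => abs_le.1 <|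
    (hR₂ (Finset.mem_image_of_mem _ hs)).trans
      (hR ▸ (le_max_right _ _).trans (le_max_right _ _))
  -- All generic ranks and centres lie in `[-R, R]`. Two large ranks reach exactly `B`, two small
  -- ones fall below `A`; a large rank plus a generic one exceeds `R`, and a small one plus a
  -- generic or large one is below `-R`, both staying within `[A, B)`.
  refine ⟨S, hS, -(8 * R + 12), 4 * R + 4, by linarith, fun s hs => ?_,
    Sum.elim r (fun x _ => if x then 2 * R + 2 else -(4 * R + 7)), ?_⟩
  · have := h2 s hs
    constructor <;> linarith
  · rintro (i | x) (j | y) a b ha hb hab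
    · simp only [Sum.elim_inl, Sum.inl.injEq, reduceCtorEq, imp_false, not_lt, not_le] at *
      have hi := h1 i a
      have hj := h1 j b
      rw [hr i j a b ha hb hab]
      have e₁ : -(8 * R + 12) ≤ r i a + r j b := by linarith
      have e₂ : r i a + r j b < 4 * R + 4 := by linarith
      exact ⟨by simp only [e₁.not_gt, e₂.not_ge, or_false], e₁, e₂⟩
    · have hi := h1 i a
      have hS : ∀ s ∈ S, r i a + (if y then 2 * R + 2 else -(4 * R + 7)) ≠ s := by
        intro s hs
        have := h2 s hs
        split_ifs <;> intro <;> linarith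
      have hA : ¬ r i a + (if y then 2 * R + 2 else -(4 * R + 7)) < -(8 * R + 12) := by
        split_ifs <;> intro <;> linarith
      have hB : ¬ 4 * R + 4 ≤ r i a + (if y then 2 * R + 2 else -(4 * R + 7)) := by
        split_ifs <;> intro <;> linarith
      simp only [Sum.elim_inl, Sum.elim_inr, reduceCtorEq, hA, hB, or_false, false_iff,
        false_imp_iff, and_true]
      exact fun h => hS _ h rfl
    · have hi := h1 j b
      have hS : ∀ s ∈ S, (if x then 2 * R + 2 else -(4 * R + 7)) + r j b ≠ s := by
        intro s hs
        have := h2 s hs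
        split_ifs <;> intro <;> linarith
      have hA : ¬ (if x then 2 * R + 2 else -(4 * R + 7)) + r j b < -(8 * R + 12) := by
        split_ifs <;> intro <;> linarith
      have hB : ¬ 4 * R + 4 ≤ (if x then 2 * R + 2 else -(4 * R + 7)) + r j b := by
        split_ifs <;> intro <;> linarith
      simp only [Sum.elim_inl, Sum.elim_inr, reduceCtorEq, hA, hB, or_false, false_iff,
        false_imp_iff, and_true]
      exact fun h => hS _ h rfl
    · simp only [Sum.elim_inr, Sum.inr.injEq]
      cases x <;> cases y <;> simp only [if_true, if_false, Bool.false_eq_true, true_iff,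
        reduceCtorEq, false_iff, implies_true, imp_false, not_or, not_lt, not_le, true_and,
        and_true]
      · exact ⟨Or.inr (Or.inl (by linarith)), by linarith⟩
      · exact ⟨⟨fun h => by linarith [(h2 _ h).1], by linarith, by linarith⟩, by linarith⟩
      · exact ⟨⟨fun h => by linarith [(h2 _ h).1], by linarith, by linarith⟩, by linarith⟩
      · exact ⟨Or.inr (Or.inr (by linarith)), by linarith⟩

/-- The given clusters fit into the generic ones and the extreme ones listed in `X`. -/
theorem exists_slots {m n₁ n₂ n₃ : ℕ} (X : Finset Bool) (h₀ : m = 0 → n₂ + n₃ ≤ X.card)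
    (h₃ : n₃ ≤ m + m.choose 3 + X.card) :
    ∃ (n : ℕ) (_ : Fin n → Fin m) (g : Fin n₁ ⊕ Fin n₂ ⊕ Fin n₃ → Slot m n₁ n ⊕ Bool),
      Function.Injective g ∧ (∀ i x, g i = .inr x → x ∈ X) ∧
      ∀ i, partSize n₁ n₂ n₃ i ≤ (g i).elim Slot.size (fun _ => 3) := by
  rcases Nat.eq_zero_or_pos m with rfl | hm
  -- With no centre available, pairs too must occupy extreme clusters.
  · obtain ⟨h⟩ := Function.Embedding.nonempty_of_card_le (α := Fin n₂ ⊕ Fin n₃) (β := X)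
      (by simpa using h₀ rfl)
    refine ⟨0, Fin.elim0, Sum.elim (fun i => .inl (.inl i)) (fun i => .inr (h i)), ?_, ?_, ?_⟩
    · rintro (i | i) (j | j) hij
      · simpa using hij
      · simp at hij
      · simp at hij
      · exact congrArg _ (h.injective (Subtype.ext (by simpa using hij)))
    · rintro (i | i) x hx
      · simp at hx
      · simp only [Sum.elim_inr, Sum.inr.injEq] at hx
        exact hx ▸ (h i).2
    · rintro (i | i | i) <;> simp [partSize, Slot.size]
  · obtain ⟨h⟩ := Function.Embedding.nonempty_of_card_le (α := Fin n₃)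
      (β := (Fin m ⊕ {T : Finset (Fin m) // T.card = 3}) ⊕ X) (by simpa using h₃)
    refine ⟨n₂, fun _ => ⟨0, hm⟩, Sum.elim (fun i => .inl (.inl i))
      (Sum.elim (fun i => .inl (.inr (.inl i)))
        (fun i => (h i).map (fun s => .inr (.inr s)) Subtype.val)), ?_, ?_, ?_⟩
    · have hinj : Function.Injective (Sum.map (fun s => (.inr (.inr s) : Slot m n₁ n₂))
          (Subtype.val : X → Bool)) :=
        Function.Injective.sumMap (Sum.inr_injective.comp Sum.inr_injective)
          Subtype.val_injective
      rintro (i | i | i) (j | j | j) hij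
      · simpa using hij
      · simp at hij
      · simp only [Sum.elim_inl, Sum.elim_inr] at hij
        cases hj : h j <;> simp [hj] at hij
      · simp at hij
      · simpa using hij
      · simp only [Sum.elim_inl, Sum.elim_inr] at hij
        cases hj : h j <;> simp [hj] at hij
      · simp only [Sum.elim_inl, Sum.elim_inr] at hij
        cases hj : h i <;> simp [hj] at hij
      · simp only [Sum.elim_inl, Sum.elim_inr] at hij
        cases hj : h i <;> simp [hj] at hij
      · exact congrArg _ (congrArg _ (h.injective (hinj hij)))
    · rintro (i | i | i) x hx
      · simp at hx
      · simp at hx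
      · simp only [Sum.elim_inr] at hx
        cases hi : h i with
        | inl s => simp [hi] at hx
        | inr y =>
          simp only [hi, Sum.map_inr, Sum.inr.injEq] at hx
          exact hx ▸ y.2
    · rintro (i | i | i)
      · simp [partSize, Slot.size]
      · simp [partSize, Slot.size]
      · simp only [Sum.elim_inr]
        cases hi : h i <;> simp [partSize, Slot.size]

/-- Ranks and thresholds for which the sums of the edges inside clusters are `m` single values, the
values below `A` if `false ∈ X`, and the values from `B` on if `true ∈ X`. -/
theorem exists_cluster_ranks {m n₁ n₂ n₃ : ℕ} (X : Finset Bool) (h₀ : m = 0 → n₂ + n₃ ≤ X.card)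
    (h₃ : n₃ ≤ m + m.choose 3 + X.card) :
    ∃ (D : Finset ℝ) (A B : ℝ), D.card = 2 * m ∧ A < B ∧ A ∉ D ∧ B ∉ D ∧
      ∃ r : (Σ i : Fin n₁ ⊕ Fin n₂ ⊕ Fin n₃, Fin (partSize n₁ n₂ n₃ i)) → ℝ,
        ∀ u v, u ≠ v →
          (Odd (level D (r u + r v)) → A ≤ r u + r v ∧ r u + r v < B) ∧
          (u.1 = v.1 ↔ Odd (level D (r u + r v)) ∨ r u + r v < A ∨ B ≤ r u + r v) ∧
          (false ∉ X → A ≤ r u + r v) ∧ (true ∉ X → r u + r v < B) := by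
  classical
  obtain ⟨n, z, g, hg, hX, hsz⟩ := exists_slots (n₁ := n₁) X h₀ h₃
  obtain ⟨S, hS, A, B, hAB, hSAB, r, hr⟩ := exists_slot_ranks_extended (n₁ := n₁) z
  have h3 : ∀ i : Slot m n₁ n ⊕ Bool, i.elim Slot.size (fun _ => 3) ≤ 3 := by
    rintro ((i | i | i) | i) <;> simp [Slot.size]
  let pos : (Σ i : Fin n₁ ⊕ Fin n₂ ⊕ Fin n₃, Fin (partSize n₁ n₂ n₃ i)) → Fin 3 :=
    fun u => ⟨u.2, u.2.2.trans_le ((hsz u.1).trans (h3 _))⟩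
  let ρ : (Σ i : Fin n₁ ⊕ Fin n₂ ⊕ Fin n₃, Fin (partSize n₁ n₂ n₃ i)) → ℝ :=
    fun u => r (g u.1) (pos u)
  -- `A` and `B` are put into `F` to keep them out of `D`, so that they can later be added as new
  -- thresholds.
  obtain ⟨F, hFA, hFB, hF⟩ : ∃ F : Finset ℝ, A ∈ F ∧ B ∈ F ∧ ∀ u v, ρ u + ρ v ∈ F :=
    ⟨insert A (insert B (Finset.univ.image fun p : _ × _ => ρ p.1 + ρ p.2)),
      Finset.mem_insert_self _ _, Finset.mem_insert_of_mem (Finset.mem_insert_self _ _),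
      fun u v => Finset.mem_insert_of_mem (Finset.mem_insert_of_mem
        (Finset.mem_image.2 ⟨(u, v), Finset.mem_univ _, rfl⟩))⟩
  obtain ⟨D, hD, hDF, hodd⟩ := exists_thresholds_of_finset F S
  have hAD : A ∉ D := fun h => lt_irrefl _ (hSAB A (hDF A h hFA)).1
  have hBD : B ∉ D := fun h => lt_irrefl _ (hSAB B (hDF B h hFB)).2
  refine ⟨D, A, B, hD.trans (by rw [hS]), hAB, hAD, hBD, ρ, fun u v huv => ?_⟩
  rw [hodd _ (hF u v)]
  obtain ⟨h₁, h₂, h₃⟩ := hr (g u.1) (g v.1) (pos u) (pos v) (u.2.2.trans_le (hsz u.1))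
    (v.2.2.trans_le (hsz v.1)) (by
      intro h hval
      obtain ⟨i, a⟩ := u
      obtain ⟨j, b⟩ := v
      obtain rfl := hg h
      exact huv (congrArg _ (Fin.ext (Fin.mk.inj (show (⟨(a : ℕ), _⟩ : Fin 3) = ⟨(b : ℕ), _⟩ from hval)))))
  refine ⟨fun h => ⟨(hSAB _ h).1.le, (hSAB _ h).2⟩, by rw [← hg.eq_iff]; exact h₁, ?_, ?_⟩
  · intro hx
    by_contra hlt
    exact hx (hX _ _ (h₂ (not_le.1 hlt)))
  · intro hx
    by_contra hlt
    exact hx (hX _ _ (h₃ (not_lt.1 hlt)))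

theorem isKThreshold_cluster123_even {m n₁ n₂ n₃ : ℕ} (h₀ : m = 0 → n₂ + n₃ ≤ 0)
    (h₃ : n₃ ≤ m + m.choose 3) : IsKThreshold (cluster123 n₁ n₂ n₃) (2 * m) := by
  obtain ⟨D, A, B, hD, -, -, -, r, hr⟩ := exists_cluster_ranks (n₁ := n₁) ∅ h₀ h₃
  refine ⟨D, hD, r, fun u v huv => ?_⟩
  obtain ⟨-, h₂, h₃, h₄⟩ := hr u v huv
  have h₃ := (h₃ (by simp)).not_gt
  have h₄ := (h₄ (by simp)).not_ge
  rw [← level]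
  simp only [cluster123]
  tauto

/-- The threshold `B` makes the sums of the large cluster odd and leaves all others unchanged. -/
theorem isKThreshold_cluster123_odd {m n₁ n₂ n₃ : ℕ} (h₀ : m = 0 → n₂ + n₃ ≤ 1)
    (h₃ : n₃ ≤ m + m.choose 3 + 1) : IsKThreshold (cluster123 n₁ n₂ n₃) (2 * m + 1) := by
  classical
  obtain ⟨D, A, B, hD, -, -, hB, r, hr⟩ := exists_cluster_ranks (n₁ := n₁) {true} h₀ h₃
  refine ⟨insert B D, by rw [Finset.card_insert_of_notMem hB, hD], r, fun u v huv => ?_⟩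
  obtain ⟨h₁, h₂, h₃, -⟩ := hr u v huv
  have h₃ := (h₃ (by simp)).not_gt
  rw [← level, odd_level_insert hB]
  simp only [cluster123]
  rw [← not_le] at h₁
  tauto

/-- The threshold `A` exchanges the parities of all sums except those of the small cluster, which
stay even. -/
theorem isKThreshold_multipartite123_odd {m n₁ n₂ n₃ : ℕ} (h₀ : m = 0 → n₂ + n₃ ≤ 1)
    (h₃ : n₃ ≤ m + m.choose 3 + 1) : IsKThreshold (multipartite123 n₁ n₂ n₃) (2 * m + 1) := by
  classical
  obtain ⟨D, A, B, hD, -, hA, -, r, hr⟩ := exists_cluster_ranks (n₁ := n₁) {false} h₀ h₃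
  refine ⟨insert A D, by rw [Finset.card_insert_of_notMem hA, hD], r, fun u v huv => ?_⟩
  obtain ⟨h₁, h₂, -, h₄⟩ := hr u v huv
  have h₄ := (h₄ (by simp)).not_ge
  rw [← level, odd_level_insert hA]
  simp only [multipartite123, SimpleGraph.completeMultipartiteGraph]
  rw [← not_le] at h₂
  tauto

/-- Sums from `B` on are flipped by both `A` and `B`, so the large cluster has even levels as well.
-/
theorem isKThreshold_multipartite123_even {m n₁ n₂ n₃ : ℕ} (h₀ : m = 0 → n₂ + n₃ ≤ 2)
    (h₃ : n₃ ≤ m + m.choose 3 + 2) : IsKThreshold (multipartite123 n₁ n₂ n₃) (2 * m + 2) := by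
  classical
  obtain ⟨D, A, B, hD, hAB, hA, hB, r, hr⟩ := exists_cluster_ranks (n₁ := n₁) Finset.univ h₀ h₃
  have hB' : B ∉ insert A D := by simp [hB, hAB.ne']
  refine ⟨insert B (insert A D), by
    rw [Finset.card_insert_of_notMem hB', Finset.card_insert_of_notMem hA, hD], r,
    fun u v huv => ?_⟩
  obtain ⟨h₁, h₂, -, -⟩ := hr u v huv
  rw [← level, odd_level_insert hB', odd_level_insert hA]
  simp only [multipartite123, SimpleGraph.completeMultipartiteGraph]
  have h₅ : B ≤ r u + r v → A ≤ r u + r v := hAB.le.trans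
  rw [← not_le] at h₁ h₂
  tauto

/-! ### Exact values of the threshold numbers -/

theorem thresholdNumber_eq {V : Type*} {G : SimpleGraph V} {k : ℕ} (h : IsKThreshold G k)
    (hmin : ∀ l, IsKThreshold G l → k ≤ l) : thresholdNumber G = k :=
  IsLeast.csInf_eq ⟨h, fun l hl => hmin l hl⟩

/-- A nonnegative integer lies in exactly one of the intervals between consecutive values of a
strictly increasing sequence. -/
theorem existsUnique_mem_interval {s : ℕ → ℕ} (hs : StrictMono s) {n : ℕ} (hn : s 0 ≤ n) :
    ∃! m : ℕ, 1 ≤ m ∧ s (m - 1) ≤ n ∧ n ≤ s m - 1 := by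
  have hex : ∃ m, n < s m := ⟨n + 1, (Nat.lt_succ_self n).trans_le (hs.id_le _)⟩
  have hpos : 1 ≤ Nat.find hex := by
    rw [Nat.one_le_iff_ne_zero]
    intro h
    have := Nat.find_spec hex
    rw [h] at this
    omega
  refine ⟨Nat.find hex, ⟨hpos, ?_, ?_⟩, ?_⟩
  · exact not_lt.1 (Nat.find_min hex (by omega))
  · have := Nat.find_spec hex
    omega
  · rintro m ⟨h₁, h₂, h₃⟩
    have h₄ : s (m - 1) < s m := hs (by omega)
    refine le_antisymm ?_ (Nat.find_min' hex (by omega))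
    have := hs.lt_iff_lt.1 (h₂.trans_lt (Nat.find_spec hex))
    omega

theorem pSeq_strictMono : StrictMono pSeq := fun a b h => by
  have := Nat.choose_le_choose 3 h.le
  simp only [pSeq]
  omega

theorem qSeq_strictMono : StrictMono qSeq := fun a b h => by
  have := Nat.choose_le_choose 3 h.le
  simp only [qSeq]
  omega

theorem mainTheorem1 (n₁ n₂ n₃ : ℕ) :
    -- (I) complete multipartite graphs
    (2 ≤ n₁ + n₂ + n₃ →
      (n₃ ≤ 2 →
        (n₂ + n₃ ≤ 1 → thresholdNumber (multipartite123 n₁ n₂ n₃) = 1) ∧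
        (n₂ + n₃ = 2 → thresholdNumber (multipartite123 n₁ n₂ n₃) = 2) ∧
        (3 ≤ n₂ + n₃ → thresholdNumber (multipartite123 n₁ n₂ n₃) = 3)) ∧
      (3 ≤ n₃ →
        (∃! m : ℕ, 1 ≤ m ∧ pSeq (m - 1) ≤ n₃ ∧ n₃ ≤ pSeq m - 1) ∧
        ∀ m : ℕ, 1 ≤ m →
          (n₃ = pSeq (m - 1) →
            thresholdNumber (multipartite123 n₁ n₂ n₃) = 2 * m) ∧
          (pSeq (m - 1) + 1 ≤ n₃ → n₃ ≤ pSeq m - 1 →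
            thresholdNumber (multipartite123 n₁ n₂ n₃) = 2 * m + 1))) ∧
    -- (II) cluster graphs
    (1 ≤ n₁ + n₂ + n₃ →
      (n₃ ≤ 1 →
        (n₂ + n₃ = 0 → thresholdNumber (cluster123 n₁ n₂ n₃) = 0) ∧
        (n₂ + n₃ = 1 → thresholdNumber (cluster123 n₁ n₂ n₃) = 1) ∧
        (2 ≤ n₂ + n₃ → thresholdNumber (cluster123 n₁ n₂ n₃) = 2)) ∧
      (2 ≤ n₃ →
        (∃! m : ℕ, 1 ≤ m ∧ qSeq (m - 1) ≤ n₃ ∧ n₃ ≤ qSeq m - 1) ∧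
        ∀ m : ℕ, 1 ≤ m →
          (n₃ = qSeq (m - 1) →
            thresholdNumber (cluster123 n₁ n₂ n₃) = 2 * m - 1) ∧
          (qSeq (m - 1) + 1 ≤ n₃ → n₃ ≤ qSeq m - 1 →
            thresholdNumber (cluster123 n₁ n₂ n₃) = 2 * m))) := by
  have c0 : Nat.choose 0 3 = 0 := rfl
  have c1 : Nat.choose 1 3 = 0 := rfl
  constructor
  · intro hn
    refine ⟨fun h3 => ⟨fun h => ?_, fun h => ?_, fun h => ?_⟩, fun h3 =>
      ⟨existsUnique_mem_interval pSeq_strictMono (by simp [pSeq]; omega), ?_⟩⟩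
    · refine thresholdNumber_eq
        (isKThreshold_multipartite123_odd (m := 0) (fun _ => h) (by omega)) fun l hl => ?_
      rcases multipartite123_bounds hn hl with ⟨m, rfl, h₁, h₂⟩ | ⟨m, rfl, h₁, h₂⟩ <;> omega
    · refine thresholdNumber_eq
        (isKThreshold_multipartite123_even (m := 0) (fun _ => h.le) (by omega)) fun l hl => ?_
      rcases multipartite123_bounds hn hl with ⟨m, rfl, h₁, h₂⟩ | ⟨m, rfl, h₁, h₂⟩ <;> omega
    · refine thresholdNumber_eq
        (isKThreshold_multipartite123_odd (m := 1) (by omega) (by omega)) fun l hl => ?_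
      rcases multipartite123_bounds hn hl with ⟨m, rfl, h₁, h₂⟩ | ⟨m, rfl, h₁, h₂⟩ <;> omega
    · intro m hm
      obtain ⟨m, rfl⟩ := Nat.exists_eq_add_of_le' hm
      simp only [pSeq, Nat.add_sub_cancel]
      refine ⟨fun h => ?_, fun h h' => ?_⟩
      · refine thresholdNumber_eq (isKThreshold_multipartite123_even (m := m) ?_ h.le)
          fun l hl => ?_
        · rintro rfl
          omega
        -- Fewer thresholds would leave at most `m` inner levels of the right parity, and the bound
        -- then falls short of `n₃`.
        · by_contra! hlt
          rcases multipartite123_bounds hn hl with ⟨j, rfl, h₁, h₂⟩ | ⟨j, rfl, h₁, h₂⟩ <;>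
          · have := Nat.choose_le_choose 3 (show j ≤ m by omega)
            omega
      · refine thresholdNumber_eq
          (isKThreshold_multipartite123_odd (m := m + 1) (by omega) (by omega)) fun l hl => ?_
        by_contra! hlt
        rcases multipartite123_bounds hn hl with ⟨j, rfl, h₁, h₂⟩ | ⟨j, rfl, h₁, h₂⟩ <;>
        · have := Nat.choose_le_choose 3 (show j ≤ m by omega)
          omega
  · intro hn
    refine ⟨fun h3 => ⟨fun h => ?_, fun h => ?_, fun h => ?_⟩, fun h3 =>
      ⟨existsUnique_mem_interval qSeq_strictMono (by simp [qSeq]; omega), ?_⟩⟩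
    · exact thresholdNumber_eq
        (isKThreshold_cluster123_even (m := 0) (fun _ => h.le) (by omega)) fun l _ => by omega
    · refine thresholdNumber_eq
        (isKThreshold_cluster123_odd (m := 0) (fun _ => h.le) (by omega)) fun l hl => ?_
      rcases cluster123_bounds hl with ⟨m, rfl, h₁, h₂⟩ | ⟨m, rfl, h₁, h₂⟩ <;> omega
    · refine thresholdNumber_eq
        (isKThreshold_cluster123_even (m := 1) (by omega) (by omega)) fun l hl => ?_
      rcases cluster123_bounds hl with ⟨m, rfl, h₁, h₂⟩ | ⟨m, rfl, h₁, h₂⟩ <;> omega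
    · intro m hm
      obtain ⟨m, rfl⟩ := Nat.exists_eq_add_of_le' hm
      simp only [qSeq, Nat.add_sub_cancel]
      refine ⟨fun h => ?_, fun h h' => ?_⟩
      · rw [show 2 * (m + 1) - 1 = 2 * m + 1 by omega]
        refine thresholdNumber_eq (isKThreshold_cluster123_odd (m := m) ?_ h.le) fun l hl => ?_
        · rintro rfl
          omega
        · by_contra! hlt
          rcases cluster123_bounds hl with ⟨j, rfl, h₁, h₂⟩ | ⟨j, rfl, h₁, h₂⟩ <;>
          · have := Nat.choose_le_choose 3 (show j ≤ m by omega)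
            omega
      · refine thresholdNumber_eq
          (isKThreshold_cluster123_even (m := m + 1) (by omega) (by omega)) fun l hl => ?_
        by_contra! hlt
        rcases cluster123_bounds hl with ⟨j, rfl, h₁, h₂⟩ | ⟨j, rfl, h₁, h₂⟩ <;>
        · have := Nat.choose_le_choose 3 (show j ≤ m by omega)
          omega
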